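/- **Theorem 1.4.** Let $n \ge 2$, let $F_n$ be the free group of rank $n$, let $F_n'' = [[F_n,F_n],[F_n,F_n]]$ be its second derived subgroup, and let $M_n = F_n/F_n''$ be the free metabelian group of rank $n$. Let $\varphi$ be an IA-endomorphism of $M_n$, i.e. an endomorphism of $M_n$ that induces the identity on the abelianization $M_n/[M_n,M_n]$, and let $\mathrm{Fix}\,\varphi = \{g \in M_n : \varphi(g) = g\}$ be its fixed point group. If $\mathrm{Fix}\,\varphi$ is finitely generated, then its rank (the minimal number of generators) is equal to $0$, equal to $1$, or greater than $n-1$. -/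

import Mathlib

/-- The free metabelian group `M_n = F_n / F_n''` of rank `n`: the quotient of the free group on
`n` generators by its second derived subgroup `F'' = [[F, F], [F, F]]`. -/
abbrev FreeMetabelianGroup (n : ℕ) : Type :=
  FreeGroup (Fin n) ⧸ derivedSeries (FreeGroup (Fin n)) 2

/-- An endomorphism of a group `G` is an IA-endomorphism if it induces the identity on the
abelianization `G / [G, G]`. -/
def IsIAEndomorphism {G : Type*} [Group G] (φ : G →* G) : Prop :=
  Abelianization.map φ = MonoidHom.id (Abelianization G)

/-- The fixed point group `Fix φ = {g | φ g = g}` of an endomorphism `φ` of a group `G`. -/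
def fixedPointGroup {G : Type*} [Group G] (φ : G →* G) : Subgroup G :=
  φ.eqLocus (MonoidHom.id G)

/-!
The proof rests on the Magnus embedding. Write `A = ℤⁿ` for the abelianization of `M = F / F''`.
For a homomorphism from `A` to a commutative group `Q`, the Fox derivatives of a word, read in
`ℤ[Q]ⁿ`, form a crossed homomorphism `D`; it kills `F''`, so it is defined on `M`. For `Q = A` it
is injective on `M'` (`eq_one_of_magnusCocycle_eq_zero`), and for every `Q` the coefficient sums of
`D g` are the coordinates of the image of `g` in `A` (`mapDomain_snd_magnusCocycle`).

Let `H = Fix φ`, finitely generated, and let `B` be its image in `A`.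

If `H ∩ M' ≠ 1`, choose `m ≠ 1` in it. As `φ` is an IA-endomorphism and `M'` is abelian, all
conjugates of `m` in `M` lie in `H`. The crossed homomorphism rule shows that the supports of
`D h`, for `h ∈ H`, lie in finitely many cosets of `B`, because `H` is finitely generated. But
conjugating `m` translates the nonempty support of `D m` by arbitrary elements of `A`. Hence `B`
has finite index in `ℤⁿ` (`finite_quotient_of_conj_mem`), and `H` needs at least `n` generators.

If `H ∩ M' = 1`, then `H` embeds in `A`, so it is abelian. Let `g, h ∈ H` have images `a, b` in `A`
and put `Q = A / ⟨a⟩`. Then `gh = hg` says that `D g ∈ ℤ[Q]ⁿ` is invariant under translation by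
`b`. If `b` has infinite order in `Q`, this forces `D g = 0`, since supports are finite, and so
`a = 0`. Thus any two elements of `B` are linearly dependent (`exists_pow_mem_zpowers`), and `H` is
cyclic.
-/

open Finsupp Multiplicative

/-! ### Crossed homomorphisms on free groups -/

section Fox

variable {X Q : Type*} [Group Q]

/-- Left translation by `q` on `ℤ[Q]^X`, the latter encoded as the group of finitely supported
functions on `Q × X`. -/
noncomputable def shift (X : Type*) (q : Q) : (Q × X →₀ ℤ) ≃+ (Q × X →₀ ℤ) :=
  Finsupp.domCongr ((Equiv.mulLeft q).prodCongr (Equiv.refl X))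

@[simp]
theorem shift_single (q r : Q) (x : X) (k : ℤ) :
    shift X q (single (r, x) k) = single (q * r, x) k := by
  simp [shift]

@[simp]
theorem shift_apply (q r : Q) (x : X) (v : Q × X →₀ ℤ) :
    shift X q v (r, x) = v (q⁻¹ * r, x) := by
  simp [shift, Finsupp.equivMapDomain_apply]

theorem shift_one (v : Q × X →₀ ℤ) : shift X (1 : Q) v = v := by
  ext ⟨r, x⟩
  simp

theorem shift_mul (q r : Q) (v : Q × X →₀ ℤ) : shift X (q * r) v = shift X q (shift X r v) := by
  ext ⟨s, x⟩
  simp [mul_assoc]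

/-- The translation action of `Q` on `ℤ[Q]^X`, as a homomorphism to the automorphism group of the
multiplicative copy of `ℤ[Q]^X`. -/
noncomputable def shiftHom (X Q : Type*) [Group Q] : Q →* MulAut (Multiplicative (Q × X →₀ ℤ)) where
  toFun q := AddEquiv.toMultiplicative (shift X q)
  map_one' := by
    ext v : 1
    exact congrArg ofAdd (shift_one v.toAdd)
  map_mul' q r := by
    ext v : 1
    exact congrArg ofAdd (shift_mul q r v.toAdd)

/-- The Magnus homomorphism attached to `π`: the homomorphism from a free group to `ℤ[Q]^X ⋊ Q`
which sends a generator `x` to the pair of the `x`-th basis vector and `π x`. -/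
noncomputable def foxHom (π : FreeGroup X →* Q) :
    FreeGroup X →* Multiplicative (Q × X →₀ ℤ) ⋊[shiftHom X Q] Q :=
  FreeGroup.lift fun x => ⟨ofAdd (single (1, x) 1), π (FreeGroup.of x)⟩

/-- The vector of Fox derivatives of a word, read in `ℤ[Q]^X` through `π`. -/
noncomputable def fox (π : FreeGroup X →* Q) (w : FreeGroup X) : Q × X →₀ ℤ :=
  (foxHom π w).left.toAdd

theorem foxHom_right (π : FreeGroup X →* Q) (w : FreeGroup X) : (foxHom π w).right = π w := by
  have : SemidirectProduct.rightHom.comp (foxHom π) = π := by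
    ext x
    simp [foxHom]
  exact DFunLike.congr_fun this w

theorem fox_of (π : FreeGroup X →* Q) (x : X) : fox π (FreeGroup.of x) = single (1, x) 1 := by
  simp [fox, foxHom]

theorem fox_one (π : FreeGroup X →* Q) : fox π 1 = 0 := by
  simp [fox]

theorem fox_mul (π : FreeGroup X →* Q) (v w : FreeGroup X) :
    fox π (v * w) = fox π v + shift X (π v) (fox π w) := by
  rw [← foxHom_right]
  simp only [fox, map_mul, SemidirectProduct.mul_left]
  rfl

theorem fox_inv (π : FreeGroup X →* Q) (w : FreeGroup X) :
    fox π w⁻¹ = -shift X (π w)⁻¹ (fox π w) := by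
  have h := fox_mul π w⁻¹ w
  rw [inv_mul_cancel, fox_one, map_inv] at h
  exact eq_neg_of_add_eq_zero_left h.symm

/-- Schreier's rewriting of the word `w` started at the coset `a`, with respect to the section `s`
of `π`: the class of `s(a) w s(a w)⁻¹` in the abelianization of `ker π`. -/
noncomputable def schreier (π : FreeGroup X →* Q) (s : Q → FreeGroup X) (hs : ∀ q, π (s q) = q)
    (a : Q) (w : FreeGroup X) : Abelianization π.ker :=
  Abelianization.of ⟨s a * w * (s (a * π w))⁻¹, by simp [MonoidHom.mem_ker, hs]⟩

theorem schreier_mul (π : FreeGroup X →* Q) (s : Q → FreeGroup X) (hs : ∀ q, π (s q) = q)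
    (a : Q) (v w : FreeGroup X) :
    schreier π s hs a (v * w) = schreier π s hs a v * schreier π s hs (a * π v) w := by
  rw [schreier, schreier, schreier, ← map_mul]
  congr 1
  ext1
  simp [mul_assoc]

/-- The kernel of the Fox derivatives on `ker π` is the derived subgroup of `ker π`. The reason is
that `fox π` determines the Schreier rewriting of a word: both are crossed homomorphisms, so it
is enough to compare them on generators. -/
theorem mem_commutator_ker_of_fox_eq_zero (π : FreeGroup X →* Q) (hπ : Function.Surjective π)
    {w : FreeGroup X} (hw : π w = 1) (h : fox π w = 0) : w ∈ ⁅π.ker, π.ker⁆ := by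
  choose s hs using hπ
  let T : (Q × X →₀ ℤ) →+ Additive (Abelianization π.ker) :=
    Finsupp.liftAddHom fun p => zmultiplesHom _
      (Additive.ofMul (schreier π s hs p.1 (FreeGroup.of p.2)))
  have schreier_one (a : Q) : schreier π s hs a 1 = 1 := by
    have := schreier_mul π s hs a 1 1
    simpa using this
  have key (v : FreeGroup X) :
      ∀ a, T (shift X a (fox π v)) = Additive.ofMul (schreier π s hs a v) := by
    induction v using FreeGroup.induction_on with
    | C1 => simp [fox_one, schreier_one]
    | of x => simp [fox_of, T]
    | inv_of x ih =>
      intro a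
      have h1 := schreier_mul π s hs a (FreeGroup.of x)⁻¹ (FreeGroup.of x)
      rw [inv_mul_cancel, schreier_one] at h1
      rw [fox_inv, map_neg, map_neg, ← shift_mul, ih, ← map_inv π,
        eq_inv_of_mul_eq_one_left h1.symm]
      rfl
    | mul v w hv hw =>
      intro a
      rw [fox_mul, map_add, map_add, hv, ← shift_mul, hw, schreier_mul]
      rfl
  have h1 : schreier π s hs 1 w = 1 := by
    have := key w 1
    rw [h, map_zero, map_zero] at this
    exact this.symm
  have h2 : (⟨s 1 * w * (s (1 * π w))⁻¹, by simp [MonoidHom.mem_ker, hs]⟩ : π.ker) ∈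
      commutator π.ker := by
    rw [← Abelianization.ker_of]
    exact h1
  have h3 := Subgroup.mem_map_of_mem π.ker.subtype h2
  rw [Subgroup.map_subtype_commutator] at h3
  simpa [hw, mul_assoc] using (inferInstance : ⁅π.ker, π.ker⁆.Normal).conj_mem _ h3 (s 1)⁻¹

end Fox

/-! ### Exponent sums and the abelianization -/

section Exponent

variable {X : Type*}

/-- The exponent sums of a word, as a homomorphism to the free abelian group on `X`, written
multiplicatively. -/
noncomputable def exponentSum (X : Type*) : FreeGroup X →* Multiplicative (X →₀ ℤ) :=
  FreeGroup.lift fun x => ofAdd (single x 1)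

theorem ker_exponentSum : (exponentSum X).ker = commutator (FreeGroup X) := by
  apply le_antisymm
  · let g : Multiplicative (X →₀ ℤ) →* Abelianization (FreeGroup X) :=
      AddMonoidHom.toMultiplicativeLeft (Finsupp.liftAddHom fun x => zmultiplesHom _
        (Additive.ofMul (Abelianization.of (FreeGroup.of x))))
    have hg : g.comp (exponentSum X) = Abelianization.of := by
      ext x
      simp [g, exponentSum]
    rw [← Abelianization.ker_of, ← hg]
    exact fun w hw => by simp [MonoidHom.mem_ker, (MonoidHom.mem_ker).1 hw]
  · exact Abelianization.commutator_subset_ker _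

theorem exponentSum_surjective : Function.Surjective (exponentSum X) := by
  intro v
  induction v using Multiplicative.rec with | _ v
  induction v using Finsupp.induction_linear with
  | zero => exact ⟨1, map_one _⟩
  | add v w hv hw =>
    obtain ⟨a, ha⟩ := hv
    obtain ⟨b, hb⟩ := hw
    exact ⟨a * b, by rw [map_mul, ha, hb]; rfl⟩
  | single x k =>
    refine ⟨FreeGroup.of x ^ k, ?_⟩
    rw [map_zpow, exponentSum, FreeGroup.lift_apply_of, ← ofAdd_zsmul]
    simp

end Exponent

/-! ### The Magnus embedding of the free metabelian group -/

section Magnus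

/-- A homomorphism to a group which is abelian-by-abelian kills the second derived subgroup. -/
theorem derivedSeries_two_le_ker {G L Q : Type*} [Group G] [Group L] [CommGroup Q]
    (f : G →* L) (r : L →* Q) (hr : ∀ a ∈ r.ker, ∀ b ∈ r.ker, a * b = b * a) :
    derivedSeries G 2 ≤ f.ker := by
  have h1 : derivedSeries G 1 ≤ (r.comp f).ker := by
    rw [derivedSeries_one]
    exact Abelianization.commutator_subset_ker _
  rw [derivedSeries_succ, Subgroup.commutator_le]
  intro a ha b hb
  rw [MonoidHom.mem_ker, map_commutatorElement, commutatorElement_eq_one_iff_mul_comm]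
  exact hr _ (h1 ha) _ (h1 hb)

variable {n : ℕ} {Q : Type*} [CommGroup Q]

/-- The Magnus homomorphism on `F / F''` with coefficients in `ℤ[Q]`, for `κ : ℤⁿ → Q`. -/
noncomputable def magnusHom (κ : Multiplicative (Fin n →₀ ℤ) →* Q) : FreeMetabelianGroup n →*
    Multiplicative (Q × Fin n →₀ ℤ) ⋊[shiftHom (Fin n) Q] Q :=
  QuotientGroup.lift _ (foxHom (κ.comp (exponentSum (Fin n)))) <|
    derivedSeries_two_le_ker _ SemidirectProduct.rightHom <| by
      rintro ⟨a, q⟩ ha ⟨b, r⟩ hb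
      obtain rfl : q = 1 := ha
      obtain rfl : r = 1 := hb
      ext1
      · simp [mul_comm]
      · rfl

/-- The crossed homomorphism `F / F'' → ℤ[Q]ⁿ` given by the Fox derivatives. -/
noncomputable def magnusCocycle (κ : Multiplicative (Fin n →₀ ℤ) →* Q)
    (g : FreeMetabelianGroup n) : Q × Fin n →₀ ℤ :=
  (magnusHom κ g).left.toAdd

/-- The abelianization map of `F / F''`, with values in `ℤⁿ`. -/
noncomputable def abelianize (n : ℕ) : FreeMetabelianGroup n →* Multiplicative (Fin n →₀ ℤ) :=
  QuotientGroup.lift _ (exponentSum (Fin n)) <|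
    derivedSeries_two_le_ker _ (MonoidHom.id _) fun _ _ _ _ => mul_comm _ _

theorem magnusCocycle_mk (κ : Multiplicative (Fin n →₀ ℤ) →* Q) (w : FreeGroup (Fin n)) :
    magnusCocycle κ (w : FreeMetabelianGroup n) = fox (κ.comp (exponentSum (Fin n))) w :=
  rfl

theorem abelianize_mk (w : FreeGroup (Fin n)) :
    abelianize n (w : FreeMetabelianGroup n) = exponentSum (Fin n) w :=
  rfl

theorem magnusCocycle_mul (κ : Multiplicative (Fin n →₀ ℤ) →* Q) (g h : FreeMetabelianGroup n) :
    magnusCocycle κ (g * h) =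
      magnusCocycle κ g + shift (Fin n) (κ (abelianize n g)) (magnusCocycle κ h) := by
  induction g using QuotientGroup.induction_on with | _ v
  induction h using QuotientGroup.induction_on with | _ w
  exact fox_mul (κ.comp (exponentSum (Fin n))) v w

theorem magnusCocycle_one (κ : Multiplicative (Fin n →₀ ℤ) →* Q) :
    magnusCocycle κ (1 : FreeMetabelianGroup n) = 0 :=
  fox_one (κ.comp (exponentSum (Fin n)))

theorem magnusCocycle_inv (κ : Multiplicative (Fin n →₀ ℤ) →* Q) (g : FreeMetabelianGroup n) :
    magnusCocycle κ g⁻¹ = -shift (Fin n) (κ (abelianize n g))⁻¹ (magnusCocycle κ g) := by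
  induction g using QuotientGroup.induction_on with | _ v
  exact fox_inv (κ.comp (exponentSum (Fin n))) v

/-- The augmentation of the Fox derivatives gives the exponent sums. -/
theorem mapDomain_snd_magnusCocycle (κ : Multiplicative (Fin n →₀ ℤ) →* Q)
    (g : FreeMetabelianGroup n) :
    (magnusCocycle κ g).mapDomain Prod.snd = (abelianize n g).toAdd := by
  have shift_aug (q : Q) (v : Q × Fin n →₀ ℤ) :
      (shift (Fin n) q v).mapDomain Prod.snd = v.mapDomain Prod.snd := by
    induction v using Finsupp.induction_linear with
    | zero => simp
    | add v w hv hw => simp [Finsupp.mapDomain_add, hv, hw]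
    | single p k => rw [← Prod.mk.eta (p := p), shift_single]; simp [Finsupp.mapDomain_single]
  induction g using QuotientGroup.induction_on with | _ w
  rw [magnusCocycle_mk, abelianize_mk]
  induction w using FreeGroup.induction_on with
  | C1 => simp [fox_one]
  | of x => simp [fox_of, exponentSum, Finsupp.mapDomain_single]
  | inv_of x ih =>
    rw [fox_inv, map_inv, toAdd_inv, ← ih, ← shift_aug ((κ.comp (exponentSum (Fin n)))
      (FreeGroup.of x))⁻¹ (fox _ (FreeGroup.of x))]
    exact map_neg (Finsupp.mapDomain.addMonoidHom Prod.snd : (Q × Fin n →₀ ℤ) →+ _) _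
  | mul v w hv hw => rw [fox_mul, Finsupp.mapDomain_add, shift_aug, hv, hw, map_mul, toAdd_mul]

theorem ker_abelianize : (abelianize n).ker = commutator (FreeMetabelianGroup n) := by
  apply le_antisymm
  · intro g hg
    induction g using QuotientGroup.induction_on with | _ w
    have hw : w ∈ derivedSeries (FreeGroup (Fin n)) 1 := by
      rw [derivedSeries_one, ← ker_exponentSum]
      exact hg
    rw [← derivedSeries_one]
    exact map_derivedSeries_le_derivedSeries (QuotientGroup.mk' _) 1
      (Subgroup.mem_map_of_mem _ hw)
  · exact Abelianization.commutator_subset_ker _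

/-- Injectivity of the Magnus embedding. -/
theorem eq_one_of_magnusCocycle_eq_zero {g : FreeMetabelianGroup n} (hg : abelianize n g = 1)
    (h : magnusCocycle (MonoidHom.id _) g = 0) : g = 1 := by
  induction g using QuotientGroup.induction_on with | _ w
  have := mem_commutator_ker_of_fox_eq_zero (exponentSum (Fin n)) exponentSum_surjective hg h
  rw [ker_exponentSum, ← derivedSeries_one, ← derivedSeries_succ] at this
  exact (QuotientGroup.eq_one_iff w).2 this

theorem mul_comm_of_abelianize_eq_one {g h : FreeMetabelianGroup n} (hg : abelianize n g = 1)
    (hh : abelianize n h = 1) : g * h = h * g := by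
  have key : derivedSeries (FreeMetabelianGroup n) 2 = ⊥ := by
    rw [← map_derivedSeries_eq (f := QuotientGroup.mk' (derivedSeries (FreeGroup (Fin n)) 2))
      (QuotientGroup.mk'_surjective _), QuotientGroup.map_mk'_self]
  rw [← MonoidHom.mem_ker, ker_abelianize, ← derivedSeries_one] at hg hh
  rw [← commutatorElement_eq_one_iff_mul_comm, ← Subgroup.mem_bot, ← key]
  exact Subgroup.commutator_mem_commutator hg hh

end Magnus

/-! ### Finitely generated subgroups containing a normal subgroup of `M` -/

section FiniteIndex

variable {n : ℕ}

/-- If a finitely generated subgroup contains all conjugates of some `m ≠ 1` in `M'`, then its image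
in `ℤⁿ` has finite index. -/
theorem finite_quotient_of_conj_mem (H : Subgroup (FreeMetabelianGroup n)) [Group.FG H]
    {m : FreeMetabelianGroup n} (hm : m ≠ 1) (hm1 : abelianize n m = 1)
    (hmH : ∀ g, g * m * g⁻¹ ∈ H) :
    Finite (Multiplicative (Fin n →₀ ℤ) ⧸ H.map (abelianize n)) := by
  classical
  set D := magnusCocycle (n := n) (MonoidHom.id _) with hD
  set B := H.map (abelianize n) with hB
  obtain ⟨S, hS⟩ := (Group.fg_iff_subgroup_fg H).1 inferInstance
  -- the finitely many cosets of `B` that meet the support of `D s` for a generator `s`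
  let C : Set (Multiplicative (Fin n →₀ ℤ) ⧸ B) :=
    ⋃ s ∈ S, (fun p : Multiplicative (Fin n →₀ ℤ) × Fin n => (p.1 : _ ⧸ B)) '' (D s).support
  have hC : C.Finite := S.finite_toSet.biUnion fun s _ => (D s).support.finite_toSet.image _
  have mk_inv_mul {b : Multiplicative (Fin n →₀ ℤ)} (hb : b ∈ B)
      (a : Multiplicative (Fin n →₀ ℤ)) : ((b⁻¹ * a : _) : _ ⧸ B) = (a : _ ⧸ B) := by
    rw [QuotientGroup.eq]
    simpa [mul_comm] using hb
  have hsupp : ∀ h ∈ H, ∀ a x, D h (a, x) ≠ 0 → (a : _ ⧸ B) ∈ C := by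
    intro h hh
    rw [← hS] at hh
    have mem_B {g : FreeMetabelianGroup n} (hg : g ∈ Subgroup.closure (S : Set _)) :
        abelianize n g ∈ B := Subgroup.mem_map_of_mem _ (hS ▸ hg)
    induction hh using Subgroup.closure_induction with
    | mem s hs =>
      intro a x ha
      exact Set.mem_biUnion hs ⟨(a, x), by simpa using ha, rfl⟩
    | one =>
      intro a x ha
      simp [hD, magnusCocycle_one] at ha
    | mul g h hg hh ihg ihh =>
      intro a x ha
      rw [hD, magnusCocycle_mul, Finsupp.add_apply, shift_apply] at ha
      by_cases h0 : D g (a, x) = 0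
      · rw [← hD, h0, zero_add] at ha
        have := ihh _ _ ha
        rwa [MonoidHom.id_apply, mk_inv_mul (mem_B hg)] at this
      · exact ihg _ _ h0
    | inv g hg ihg =>
      intro a x ha
      rw [hD, magnusCocycle_inv, Finsupp.neg_apply, shift_apply, neg_ne_zero] at ha
      have := ihg _ _ ha
      rwa [MonoidHom.id_apply, mk_inv_mul (B.inv_mem (mem_B hg))] at this
  have hDm : D m ≠ 0 := fun h => hm (eq_one_of_magnusCocycle_eq_zero hm1 h)
  obtain ⟨⟨a, x⟩, ha⟩ := Finsupp.ne_iff.1 hDm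
  have hall : ∀ q, q ∈ C := by
    intro q
    induction q using QuotientGroup.induction_on with | _ c
    -- conjugation by a preimage of `c * a⁻¹` moves `a` in the support of `D m` to `c`
    obtain ⟨w, hw⟩ := exponentSum_surjective (c * a⁻¹)
    have hg : abelianize n (w : FreeMetabelianGroup n) = c * a⁻¹ := hw
    refine hsupp _ (hmH w) c x ?_
    rw [hD, magnusCocycle_mul, magnusCocycle_mul, magnusCocycle_inv, map_mul, hm1, mul_one, hg]
    rw [map_neg, ← shift_mul, MonoidHom.id_apply, mul_inv_cancel, shift_one]
    simpa using ha
  exact Set.finite_univ_iff.1 (hC.subset fun q _ => hall q)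

theorem le_rank_of_finite_quotient (H : Subgroup (FreeMetabelianGroup n)) [Group.FG H]
    (hfin : Finite (Multiplicative (Fin n →₀ ℤ) ⧸ H.map (abelianize n))) :
    n ≤ Group.rank H := by
  classical
  obtain ⟨S, hS, hcl⟩ := Group.rank_spec H
  let f : H → (Fin n →₀ ℤ) := fun h => (abelianize n h).toAdd
  let N : Submodule ℤ (Fin n →₀ ℤ) := Submodule.span ℤ (S.image f : Set (Fin n →₀ ℤ))
  have hN : ∀ h : H, f h ∈ N := by
    intro h
    have hh : h ∈ Subgroup.closure (S : Set H) := hcl ▸ Subgroup.mem_top h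
    induction hh using Subgroup.closure_induction with
    | mem s hs => exact Submodule.subset_span (by simpa using ⟨s, s.2, hs, rfl⟩)
    | one => simp [f]
    | mul g h _ _ hg hh => simpa [f] using N.add_mem hg hh
    | inv g _ hg => simpa [f] using hg
  have hfinN : Finite ((Fin n →₀ ℤ) ⧸ N) := by
    have : Function.Surjective (Quotient.lift
        (fun a : Multiplicative (Fin n →₀ ℤ) => (N.mkQ a.toAdd)) (by
          intro a b hab
          obtain ⟨h, hh, heq⟩ := QuotientGroup.leftRel_apply.1 hab
          refine ((Submodule.Quotient.eq' N).2 ?_)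
          have := hN ⟨h, hh⟩
          simp only [f, heq] at this
          exact this) : Multiplicative (Fin n →₀ ℤ) ⧸ H.map (abelianize n) → _) := by
      intro q
      obtain ⟨v, rfl⟩ := N.mkQ_surjective q
      exact ⟨QuotientGroup.mk (ofAdd v), rfl⟩
    exact Finite.of_surjective _ this
  have h1 := (Submodule.finiteQuotient_iff N).1 hfinN
  have h2 : Module.finrank ℤ N ≤ (S.image f).card := finrank_span_finset_le_card _
  have h3 : Module.finrank ℤ (Fin n →₀ ℤ) = n := by simp
  have h4 : (S.image f).card ≤ S.card := Finset.card_image_le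
  omega

end FiniteIndex

/-! ### Abelian subgroups that meet `M'` trivially -/

section Abelian

variable {n : ℕ}

/-- A finitely supported function on `Q × X` which is invariant under translation by an element
of infinite order vanishes. -/
theorem eq_zero_of_shift_eq {X Q : Type*} [Group Q] {b : Q} (hb : ∀ k : ℕ, 0 < k → b ^ k ≠ 1)
    {v : Q × X →₀ ℤ} (hv : shift X b v = v) : v = 0 := by
  by_contra h
  obtain ⟨⟨a, x⟩, ha⟩ := Finsupp.ne_iff.1 h
  have hpow : ∀ k : ℕ, shift X (b ^ k) v = v := by
    intro k
    induction k with
    | zero => rw [pow_zero, shift_one]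
    | succ k ih => rw [pow_succ, shift_mul, hv, ih]
  have hinj : Function.Injective fun k : ℕ => (b ^ k * a, x) := by
    intro k l hkl
    have hinj' : Function.Injective fun k : ℕ => b ^ k :=
      injective_pow_iff_not_isOfFinOrder.2 fun hfin => by
        obtain ⟨k, hk, hk1⟩ := isOfFinOrder_iff_pow_eq_one.1 hfin
        exact hb k hk hk1
    exact hinj' (mul_right_cancel (Prod.ext_iff.1 hkl).1)
  refine Set.infinite_of_injective_forall_mem hinj (fun k => ?_) v.support.finite_toSet
  have := DFunLike.congr_fun (hpow k) (b ^ k * a, x)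
  rw [shift_apply, inv_mul_cancel_left] at this
  simpa [← this] using ha

/-- Commuting elements have linearly dependent images in `ℤⁿ`: otherwise the Fox derivatives of `g`
modulo the image of `g` would be invariant under a translation of infinite order. -/
theorem exists_pow_mem_zpowers {g h : FreeMetabelianGroup n} (hgh : g * h = h * g)
    (hg : abelianize n g ≠ 1) :
    ∃ k : ℕ, 0 < k ∧ abelianize n h ^ k ∈ Subgroup.zpowers (abelianize n g) := by
  by_contra! hcon
  let κ := QuotientGroup.mk' (Subgroup.zpowers (abelianize n g))
  have hκ : κ (abelianize n g) = 1 :=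
    (QuotientGroup.eq_one_iff _).2 (Subgroup.mem_zpowers _)
  have h1 : magnusCocycle κ g = 0 := by
    refine eq_zero_of_shift_eq (b := κ (abelianize n h)) (fun k hk h1 => ?_) ?_
    · rw [← map_pow] at h1
      exact hcon k hk ((QuotientGroup.eq_one_iff _).1 h1)
    · have := congrArg (magnusCocycle κ) hgh
      rw [magnusCocycle_mul, magnusCocycle_mul, hκ, shift_one, add_comm] at this
      exact (add_left_cancel this).symm
  apply hg
  have := mapDomain_snd_magnusCocycle κ g
  rw [h1, Finsupp.mapDomain_zero] at this
  exact this.symm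

/-- A subgroup of `F / F''` that embeds in the abelianization is cyclic. -/
theorem isCyclic_of_injOn_abelianize (H : Subgroup (FreeMetabelianGroup n))
    (hH : ∀ h ∈ H, abelianize n h = 1 → h = 1) : IsCyclic H := by
  have hinj : Function.Injective ((abelianize n).comp H.subtype) := by
    rw [injective_iff_map_eq_one]
    intro h hh
    exact Subtype.ext (hH h h.2 hh)
  have hcomm : ∀ g h : H, g * h = h * g := fun g h => hinj (by rw [map_mul, map_mul, mul_comm])
  let N : Submodule ℤ (Fin n →₀ ℤ) :=
    AddSubgroup.toIntSubmodule (Subgroup.toAddSubgroup' ((abelianize n).comp H.subtype).range)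
  have hN (v : N) : ∃ h : H, abelianize n h = ofAdd (v : Fin n →₀ ℤ) := v.2
  let b := Module.finBasis ℤ N
  have hr : Subsingleton (Fin (Module.finrank ℤ N)) := by
    refine ⟨fun i j => ?_⟩
    by_contra hij
    obtain ⟨g, hg⟩ := hN (b i)
    obtain ⟨h, hh⟩ := hN (b j)
    have hg1 : abelianize n g ≠ 1 := by
      rw [hg]
      intro h0
      exact b.ne_zero i (Subtype.ext h0)
    obtain ⟨k, hk, l, hl⟩ := exists_pow_mem_zpowers (congrArg Subtype.val (hcomm g h)) hg1
    have hl' : l • b i = (k : ℤ) • b j := by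
      apply Subtype.ext
      simp only [hg, hh] at hl
      simpa using congrArg toAdd hl
    have := DFunLike.congr_fun (congrArg b.repr hl') j
    simp [hij] at this
    omega
  have hcyc : ∃ v : N, ∀ w : N, ∃ k : ℤ, w = k • v := by
    rcases isEmpty_or_nonempty (Fin (Module.finrank ℤ N)) with he | ⟨⟨i⟩⟩
    · exact ⟨0, fun w => ⟨0, b.repr.injective (Subsingleton.elim _ _)⟩⟩
    · refine ⟨b i, fun w => ⟨b.repr w i, b.repr.injective (Finsupp.ext fun j => ?_)⟩⟩
      obtain rfl := Subsingleton.elim i j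
      simp
  obtain ⟨v, hv⟩ := hcyc
  obtain ⟨g, hg⟩ := hN v
  refine ⟨g, fun h => ?_⟩
  obtain ⟨k, hk⟩ := hv ⟨(abelianize n h).toAdd, h, rfl⟩
  refine ⟨k, hinj ?_⟩
  have hk' : (abelianize n h).toAdd = k • (v : Fin n →₀ ℤ) := congrArg Subtype.val hk
  rw [map_zpow]
  change abelianize n g ^ k = abelianize n h
  rw [hg, ← ofAdd_zsmul, ← hk', ofAdd_toAdd]

end Abelian

/-! ### Fixed points of IA-endomorphisms -/

/-- An IA-endomorphism commutes with conjugation on `M'`: it changes the conjugating element only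
by an element of the abelian group `M'`. -/
theorem conj_mem_fixedPointGroup {n : ℕ} {φ : FreeMetabelianGroup n →* FreeMetabelianGroup n}
    (hφ : IsIAEndomorphism φ) {m : FreeMetabelianGroup n} (hm : m ∈ fixedPointGroup φ)
    (hm1 : abelianize n m = 1) (g : FreeMetabelianGroup n) :
    g * m * g⁻¹ ∈ fixedPointGroup φ := by
  have hc : abelianize n (g⁻¹ * φ g) = 1 := by
    have h1 : Abelianization.of (φ g) = Abelianization.of g := by
      rw [← Abelianization.map_of, hφ, MonoidHom.id_apply]
    rw [← MonoidHom.mem_ker, ker_abelianize, ← Abelianization.ker_of, MonoidHom.mem_ker, map_mul,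
      h1, map_inv, inv_mul_cancel]
  have hm' : φ m = m := hm
  have hcm := mul_comm_of_abelianize_eq_one hc hm1
  change φ (g * m * g⁻¹) = g * m * g⁻¹
  rw [map_mul, map_mul, map_inv, hm', mul_inv_eq_iff_eq_mul]
  calc φ g * m = g * (g⁻¹ * φ g * m) := by group
    _ = g * m * g⁻¹ * φ g := by rw [hcm]; group

theorem theorem1p4 (n : ℕ) (hn : 2 ≤ n)
    (φ : FreeMetabelianGroup n →* FreeMetabelianGroup n) (hφ : IsIAEndomorphism φ)
    [Group.FG (fixedPointGroup φ)] :
    Group.rank (fixedPointGroup φ) = 0 ∨ Group.rank (fixedPointGroup φ) = 1 ∨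
      n - 1 < Group.rank (fixedPointGroup φ) := by
  by_cases hH : ∀ h ∈ fixedPointGroup φ, abelianize n h = 1 → h = 1
  · obtain ⟨g, hg⟩ := isCyclic_of_injOn_abelianize _ hH
    have hle : Group.rank (fixedPointGroup φ) ≤ ({g} : Finset (fixedPointGroup φ)).card := by
      refine Group.rank_le ?_
      rw [Finset.coe_singleton, ← Subgroup.zpowers_eq_closure, Subgroup.eq_top_iff']
      exact hg
    rw [Finset.card_singleton] at hle
    omega
  · push Not at hH
    obtain ⟨m, hm, hm1, hne⟩ := hH
    have := le_rank_of_finite_quotient _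
      (finite_quotient_of_conj_mem _ hne hm1 (conj_mem_fixedPointGroup hφ hm hm1))
    omega
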